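/- Let $X$ be a locally compact Hausdorff space equipped with a $\sigma$-finite Radon measure $\mu$ with support $X$. For $f\in L^2(X\times X)$ let $K_f$ be the Hilbert--Schmidt operator on $L^2(X)$ given by $(K_f\xi)(x)=\int_X f(x,y)\xi(y)\,d\mu(y)$. A function $\varphi\in L^\infty(X\times X)$ induces a measurable Schur multiplier if the map $K_f\mapsto K_{\varphi f}$ on Hilbert--Schmidt operators is bounded for the operator norm; the measurable Schur multiplier $M_\varphi\colon B(L^2(X))\to B(L^2(X))$ with symbol $\varphi$ is then the unique weak* continuous linear extension of this map. Call $M_\varphi$ positive if it maps positive operators to positive operators, and trace preserving if for every trace class operator $T$ on $L^2(X)$ the operator $M_\varphi(T)$ is trace class and $\operatorname{tr} M_\varphi(T)=\operatorname{tr} T$. Let $\varphi\colon X\times X\to\mathbb{C}$ be a continuous function that induces a measurable Schur multiplier $M_\varphi$, and suppose that $M_\varphi$ is positive. Then $M_\varphi$ is trace preserving if and only if $\varphi(x,x)=1$ for every $x\in X$. -/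

import Mathlib

open MeasureTheory
open scoped ENNReal

noncomputable section

namespace SchurMult

/-! ### Trace class operators, the trace, and the weak* topology of `B(H)` -/

section Trace

variable (H : Type*) [NormedAddCommGroup H] [InnerProductSpace ℂ H] [CompleteSpace H]

/-- The index set of a fixed orthonormal (Hilbert) basis of `H`. -/
def basisIndex : Set H := (exists_hilbertBasis ℂ H).choose

/-- A fixed orthonormal (Hilbert) basis of `H`. The notions defined with it below, trace class and
trace, do not depend on which basis is fixed. -/
def basis : HilbertBasis (basisIndex H) ℂ H := (exists_hilbertBasis ℂ H).choose_spec.choose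

variable {H}

/-- `T` is trace class: `∑ᵢ ⟨eᵢ, |T| eᵢ⟩ < ∞`, where `|T| = (T⋆ T)^(1/2)`. -/
def IsTraceClass (T : H →L[ℂ] H) : Prop :=
  Summable fun i => (inner ℂ (basis H i) (CFC.abs T (basis H i))).re

/-- The trace `∑ᵢ ⟨eᵢ, T eᵢ⟩` (meaningful for a trace class operator `T`). -/
def trace (T : H →L[ℂ] H) : ℂ := ∑' i, inner ℂ (basis H i) (T (basis H i))

variable (H) in
/-- The weak* topology of `B(H)`, as the dual of the space of trace class operators: the coarsest
topology for which `T ↦ tr (T S)` is continuous for every trace class operator `S`. -/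
abbrev weakStarTopology : TopologicalSpace (H →L[ℂ] H) :=
  ⨅ S : {S : H →L[ℂ] H // IsTraceClass S},
    TopologicalSpace.induced (fun T => trace (T ∘L S.1)) inferInstance

/-- `M` is weak* continuous. -/
def IsWeakStarContinuous (M : (H →L[ℂ] H) →ₗ[ℂ] (H →L[ℂ] H)) : Prop :=
  @Continuous _ _ (weakStarTopology H) (weakStarTopology H) M

/-- `M` is positive: it maps positive operators to positive operators. -/
def IsPositiveMap (M : (H →L[ℂ] H) →ₗ[ℂ] (H →L[ℂ] H)) : Prop :=
  ∀ T : H →L[ℂ] H, T.IsPositive → (M T).IsPositive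

/-- `M` is trace preserving: it maps trace class operators to trace class operators and
`tr M(T) = tr T` for every trace class operator `T`. -/
def IsTracePreserving (M : (H →L[ℂ] H) →ₗ[ℂ] (H →L[ℂ] H)) : Prop :=
  ∀ T : H →L[ℂ] H, IsTraceClass T → IsTraceClass (M T) ∧ trace (M T) = trace T

end Trace

/-! ### Hilbert-Schmidt integral operators -/

section Kernel

variable {X : Type*} [MeasurableSpace X] {μ : Measure X} [SigmaFinite μ]

/-- The function `x ↦ ∫ f(x,y) ξ(y) dμ(y)`. -/
def kernelFun (μ : Measure X) (f : X × X → ℂ) (ξ : X → ℂ) : X → ℂ :=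
  fun x => ∫ y, f (x, y) * ξ y ∂μ

theorem eLpNorm_two_sq {α : Type*} [MeasurableSpace α] (ν : Measure α) (g : α → ℂ) :
    eLpNorm g 2 ν ^ 2 = ∫⁻ a, ‖g a‖ₑ ^ 2 ∂ν := by
  simpa using eLpNorm_nnreal_pow_eq_lintegral (μ := ν) (f := g) (p := 2) two_ne_zero

theorem eLpNorm_two_prod {f : X × X → ℂ} (hf : AEStronglyMeasurable f (μ.prod μ)) :
    ∫⁻ x, eLpNorm (fun y => f (x, y)) 2 μ ^ 2 ∂μ = eLpNorm f 2 (μ.prod μ) ^ 2 := by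
  rw [eLpNorm_two_sq, lintegral_prod _ (hf.enorm.pow_const 2)]
  simp only [eLpNorm_two_sq]

theorem ae_memLp_section {f : X × X → ℂ} (hf : MemLp f 2 (μ.prod μ)) :
    ∀ᵐ x ∂μ, MemLp (fun y => f (x, y)) 2 μ := by
  have hm : AEMeasurable (fun x => eLpNorm (fun y => f (x, y)) 2 μ ^ 2) μ := by
    simp only [eLpNorm_two_sq]
    exact (hf.1.enorm.pow_const 2).lintegral_prod_right'
  have hfin : ∫⁻ x, eLpNorm (fun y => f (x, y)) 2 μ ^ 2 ∂μ ≠ ∞ := by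
    rw [eLpNorm_two_prod hf.1]
    exact (ENNReal.pow_lt_top hf.2).ne
  filter_upwards [ae_lt_top' hm hfin, hf.1.prodMk_left] with x hx hx'
  exact ⟨hx', by simpa using hx⟩

theorem aestronglyMeasurable_kernelFun {f : X × X → ℂ} (hf : MemLp f 2 (μ.prod μ))
    {ξ : X → ℂ} (hξ : MemLp ξ 2 μ) : AEStronglyMeasurable (kernelFun μ f ξ) μ :=
  AEStronglyMeasurable.integral_prod_right' (f := fun z : X × X => f z * ξ z.2)
    (hf.1.mul (hξ.1.comp_snd))

theorem eLpNorm_kernelFun_le {f : X × X → ℂ} (hf : MemLp f 2 (μ.prod μ))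
    {ξ : X → ℂ} (hξ : MemLp ξ 2 μ) :
    eLpNorm (kernelFun μ f ξ) 2 μ ≤ eLpNorm f 2 (μ.prod μ) * eLpNorm ξ 2 μ := by
  have hb : ∀ᵐ x ∂μ, ‖kernelFun μ f ξ x‖ₑ ^ 2 ≤
      eLpNorm (fun y => f (x, y)) 2 μ ^ 2 * eLpNorm ξ 2 μ ^ 2 := by
    filter_upwards [ae_memLp_section hf] with x hx
    rw [← mul_pow]
    gcongr
    calc ‖kernelFun μ f ξ x‖ₑ ≤ ∫⁻ y, ‖f (x, y) * ξ y‖ₑ ∂μ := enorm_integral_le_lintegral_enorm _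
      _ = eLpNorm ((fun y => f (x, y)) • ξ) 1 μ := by
          rw [eLpNorm_one_eq_lintegral_enorm]; rfl
      _ ≤ _ := eLpNorm_smul_le_mul_eLpNorm hξ.1 hx.1
  have : eLpNorm (kernelFun μ f ξ) 2 μ ^ 2 ≤ (eLpNorm f 2 (μ.prod μ) * eLpNorm ξ 2 μ) ^ 2 := by
    rw [eLpNorm_two_sq, mul_pow, ← eLpNorm_two_prod hf.1,
      ← lintegral_mul_const' _ _ (ENNReal.pow_lt_top hξ.2).ne]
    exact lintegral_mono_ae hb
  exact (ENNReal.pow_le_pow_left_iff two_ne_zero).1 this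

theorem memLp_kernelFun {f : X × X → ℂ} (hf : MemLp f 2 (μ.prod μ))
    {ξ : X → ℂ} (hξ : MemLp ξ 2 μ) : MemLp (kernelFun μ f ξ) 2 μ :=
  ⟨aestronglyMeasurable_kernelFun hf hξ,
    (eLpNorm_kernelFun_le hf hξ).trans_lt (ENNReal.mul_lt_top hf.2 hξ.2)⟩

/-- The Hilbert-Schmidt operator `K_f : L²(X) → L²(X)`, `(K_f ξ)(x) = ∫ f(x,y) ξ(y) dμ(y)`, of a
kernel `f ∈ L²(X × X)`. -/
def kernelOp (μ : Measure X) [SigmaFinite μ] (f : X × X → ℂ) (hf : MemLp f 2 (μ.prod μ)) :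
    Lp ℂ 2 μ →L[ℂ] Lp ℂ 2 μ :=
  LinearMap.mkContinuous
    { toFun := fun ξ => (memLp_kernelFun hf (Lp.memLp ξ)).toLp
      map_add' := by
        intro ξ η
        rw [← MemLp.toLp_add]
        apply MemLp.toLp_congr
        filter_upwards [ae_memLp_section hf] with x hx
        simp only [kernelFun, Pi.add_apply]
        refine Eq.trans ?_
          (integral_add (hx.integrable_mul (Lp.memLp ξ)) (hx.integrable_mul (Lp.memLp η)))
        apply integral_congr_ae
        filter_upwards [Lp.coeFn_add ξ η] with y hy
        rw [hy, Pi.add_apply, mul_add]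
      map_smul' := by
        intro c ξ
        rw [RingHom.id_apply, ← MemLp.toLp_const_smul]
        apply MemLp.toLp_congr
        refine Filter.Eventually.of_forall fun x => ?_
        simp only [kernelFun, Pi.smul_apply]
        rw [← integral_smul]
        apply integral_congr_ae
        filter_upwards [Lp.coeFn_smul c ξ] with y hy
        rw [hy, Pi.smul_apply, smul_eq_mul, smul_eq_mul, mul_left_comm] }
    (eLpNorm f 2 (μ.prod μ)).toReal
    (by
      intro ξ
      simp only [LinearMap.coe_mk, AddHom.coe_mk, Lp.norm_toLp]
      rw [Lp.norm_def, ← ENNReal.toReal_mul]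
      exact ENNReal.toReal_mono (ENNReal.mul_lt_top hf.2 (Lp.memLp ξ).2).ne
        (eLpNorm_kernelFun_le hf (Lp.memLp ξ)))

end Kernel

/-! ### Measurable Schur multipliers -/

section Schur

variable {X : Type*} [MeasurableSpace X]

theorem memLp_mul {μ : Measure X} {φ f : X × X → ℂ} (hφ : MemLp φ ∞ (μ.prod μ))
    (hf : MemLp f 2 (μ.prod μ)) : MemLp (fun z => φ z * f z) 2 (μ.prod μ) :=
  hf.mul hφ

/-- `φ ∈ L^∞(X × X)` induces a measurable Schur multiplier: the map `K_f ↦ K_{φ f}` on the space of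
Hilbert-Schmidt operators is bounded for the operator norm of `B(L²(X))`. -/
def InducesSchurMultiplier (μ : Measure X) [SigmaFinite μ] (φ : X × X → ℂ)
    (hφ : MemLp φ ∞ (μ.prod μ)) : Prop :=
  ∃ C : ℝ, ∀ (f : X × X → ℂ) (hf : MemLp f 2 (μ.prod μ)),
    ‖kernelOp μ (fun z => φ z * f z) (memLp_mul hφ hf)‖ ≤ C * ‖kernelOp μ f hf‖

/-- `M` is the measurable Schur multiplier `M_φ` on `B(L²(X))`: the symbol `φ ∈ L^∞(X × X)` induces
a measurable Schur multiplier and `M` is the (unique) weak* continuous linear extension to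
`B(L²(X))` of the map `K_f ↦ K_{φ f}` on the Hilbert-Schmidt operators. -/
def IsSchurMultiplier (μ : Measure X) [SigmaFinite μ] (φ : X × X → ℂ)
    (M : (Lp ℂ 2 μ →L[ℂ] Lp ℂ 2 μ) →ₗ[ℂ] (Lp ℂ 2 μ →L[ℂ] Lp ℂ 2 μ)) : Prop :=
  ∃ hφ : MemLp φ ∞ (μ.prod μ), InducesSchurMultiplier μ φ hφ ∧ IsWeakStarContinuous M ∧
    ∀ (f : X × X → ℂ) (hf : MemLp f 2 (μ.prod μ)),
      M (kernelOp μ f hf) = kernelOp μ (fun z => φ z * f z) (memLp_mul hφ hf)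

end Schur

end SchurMult

end

noncomputable section

namespace SchurMult

/-! ### Hilbert-Schmidt operators and the polar decomposition -/

section HilbertSchmidt

variable {H : Type*} [NormedAddCommGroup H] [InnerProductSpace ℂ H] [CompleteSpace H]

open ContinuousLinearMap

/-! Everything rests on the formula tr M(|ξ⟩⟨ξ|) = ∫ φ(x,x) |ξ(x)|² dμ(x), where both sides may be
infinite a priori (`IsSchurMultiplier.posTrace_rankOne`). Since tr |ξ⟩⟨ξ| = ∫ |ξ|² dμ, testing on
indicator functions shows that rank one traces are preserved exactly when φ(x,x) = 1 almost
everywhere; continuity and full support make this hold everywhere.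

For the formula, averaging over small neighbourhoods recovers values of φ as limits of matrix
coefficients of positive operators M(|ξ⟩⟨ξ|), so φ is a positive definite kernel. Hence φ(x,y) = ⟨v
x, v y⟩ for a map v into a Hilbert space, and v is bounded and continuous because φ is. Then
M(|ξ⟩⟨ξ|) = B⋆B with B η = ∫ η ξ̄ v dμ, and a vector-valued Parseval identity gives ∑ᵢ ‖B eᵢ‖² = ∫
‖v(x)‖² |ξ(x)|² dμ(x), where ‖v(x)‖² = φ(x,x).

Passing from rank one to all trace class operators (`IsPositiveMap.isTracePreserving_iff`) uses
polarization into operators C⋆C and the expansion of C⋆C into rank one operators, with which a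
positive map commutes. -/

theorem tsum_enorm_inner_sq {E ι : Type*} [NormedAddCommGroup E] [InnerProductSpace ℂ E]
    (b : HilbertBasis ι ℂ E) (x : E) :
    ∑' i, ‖inner ℂ (b i) x‖ₑ ^ 2 = ‖x‖ₑ ^ 2 := by
  have h := b.hasSum_inner_mul_inner x x
  have h1 : HasSum (fun i => ‖inner ℂ (b i) x‖ ^ 2) (‖x‖ ^ 2) := by
    have := Complex.hasSum_re h
    convert this using 1
    · ext i
      rw [← inner_conj_symm x (b i), RCLike.conj_mul]
      norm_cast
    · simpa using (inner_self_eq_norm_sq (𝕜 := ℂ) x).symm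
  have h2 := ENNReal.ofReal_tsum_of_nonneg (fun i => by positivity) h1.summable
  rw [h1.tsum_eq] at h2
  simpa [ENNReal.ofReal_pow, ofReal_norm] using h2.symm

/-- Both sides are the double sum of |⟨c j, A (b i)⟩|², in the two orders. -/
theorem tsum_enorm_sq_adjoint {ι κ : Type*} (b : HilbertBasis ι ℂ H) (c : HilbertBasis κ ℂ H)
    (A : H →L[ℂ] H) : ∑' i, ‖A (b i)‖ₑ ^ 2 = ∑' j, ‖adjoint A (c j)‖ₑ ^ 2 := by
  simp_rw [← tsum_enorm_inner_sq c (A _), ← tsum_enorm_inner_sq b (adjoint A _)]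
  rw [ENNReal.tsum_comm]
  refine tsum_congr fun j => tsum_congr fun i => ?_
  rw [adjoint_inner_right, ← inner_conj_symm, RCLike.enorm_conj]

/-- `A` is a Hilbert-Schmidt operator. -/
def IsHilbertSchmidt (A : H →L[ℂ] H) : Prop :=
  ∑' i, ‖A (basis H i)‖ₑ ^ 2 ≠ ∞

theorem IsHilbertSchmidt.summable {A : H →L[ℂ] H} (hA : IsHilbertSchmidt A) :
    Summable fun i => ‖A (basis H i)‖ ^ 2 := by
  have := ENNReal.summable_toReal hA
  simpa using this

theorem IsHilbertSchmidt.of_summable {A : H →L[ℂ] H}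
    (hA : Summable fun i => ‖A (basis H i)‖ ^ 2) : IsHilbertSchmidt A := by
  have := ENNReal.ofReal_tsum_of_nonneg (fun i => by positivity) hA
  simp only [ENNReal.ofReal_pow, norm_nonneg, ofReal_norm] at this
  rw [IsHilbertSchmidt, ← this]
  exact ENNReal.ofReal_ne_top

theorem IsHilbertSchmidt.adjoint {A : H →L[ℂ] H} (hA : IsHilbertSchmidt A) :
    IsHilbertSchmidt (adjoint A) := by
  rw [IsHilbertSchmidt, ← tsum_enorm_sq_adjoint (basis H) (basis H)]
  exact hA

theorem IsHilbertSchmidt.comp_left {A : H →L[ℂ] H} (hA : IsHilbertSchmidt A) (U : H →L[ℂ] H) :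
    IsHilbertSchmidt (U ∘L A) := by
  refine .of_summable (Summable.of_nonneg_of_le (fun _ => by positivity) (fun i => ?_)
    (hA.summable.mul_left (‖U‖ ^ 2)))
  rw [← mul_pow]
  exact pow_le_pow_left₀ (norm_nonneg _) (U.le_opNorm _) 2

theorem IsHilbertSchmidt.comp_right {A : H →L[ℂ] H} (hA : IsHilbertSchmidt A) (U : H →L[ℂ] H) :
    IsHilbertSchmidt (A ∘L U) := by
  have := (hA.adjoint.comp_left (ContinuousLinearMap.adjoint U)).adjoint
  rwa [adjoint_comp, adjoint_adjoint, adjoint_adjoint] at this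

theorem IsHilbertSchmidt.add {A B : H →L[ℂ] H} (hA : IsHilbertSchmidt A)
    (hB : IsHilbertSchmidt B) : IsHilbertSchmidt (A + B) := by
  refine .of_summable (Summable.of_nonneg_of_le (fun _ => by positivity) (fun i => ?_)
    ((hA.summable.add hB.summable).mul_left 2))
  have h := norm_add_le (A (basis H i)) (B (basis H i))
  rw [add_apply]
  nlinarith [sq_nonneg (‖A (basis H i)‖ - ‖B (basis H i)‖), norm_nonneg (A (basis H i)),
    norm_nonneg (B (basis H i)), norm_nonneg (A (basis H i) + B (basis H i))]

theorem IsHilbertSchmidt.smul {A : H →L[ℂ] H} (hA : IsHilbertSchmidt A) (c : ℂ) :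
    IsHilbertSchmidt (c • A) := by
  refine .of_summable ?_
  simpa [norm_smul, mul_pow] using hA.summable.mul_left (‖c‖ ^ 2)

theorem IsHilbertSchmidt.summable_inner {A B : H →L[ℂ] H} (hA : IsHilbertSchmidt A)
    (hB : IsHilbertSchmidt B) :
    Summable fun i => inner ℂ (A (basis H i)) (B (basis H i)) := by
  refine Summable.of_norm_bounded (hA.summable.add hB.summable) fun i => ?_
  have h := norm_inner_le_norm (𝕜 := ℂ) (A (basis H i)) (B (basis H i))
  nlinarith [sq_nonneg (‖A (basis H i)‖ - ‖B (basis H i)‖), norm_nonneg (A (basis H i)),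
    norm_nonneg (B (basis H i))]

/-- Operators with `‖T x‖ = ‖P x‖` for all `x` differ by a contraction. -/
theorem exists_contraction_comp_eq {P T : H →L[ℂ] H} (h : ∀ x, ‖T x‖ = ‖P x‖) :
    ∃ U : H →L[ℂ] H, U ∘L P = T ∧ ‖U‖ ≤ 1 := by
  let R : Submodule ℂ H := (LinearMap.range (P : H →ₗ[ℂ] H)).topologicalClosure
  have hR : ∀ x, P x ∈ R := fun x => Submodule.le_topologicalClosure _ ⟨x, rfl⟩
  have : CompleteSpace R := (Submodule.isClosed_topologicalClosure _).completeSpace_coe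
  let e : H →ₗ[ℂ] R := (P : H →ₗ[ℂ] H).codRestrict R hR
  have he : DenseRange e := by
    intro y
    rw [closure_subtype]
    have hy : (y : H) ∈ closure (Set.range P) := y.2
    convert hy using 2
    rw [← Set.range_comp]
    rfl
  have hn : ∀ x, ‖(T : H →ₗ[ℂ] H) x‖ ≤ 1 * ‖e x‖ := fun x => by
    rw [one_mul]
    exact (h x).le
  -- The assignment `P x ↦ T x` is isometric on the range of `P`, hence extends to its closure `R`;
  -- the projection onto `R` makes the extension zero on the orthogonal complement.
  let V : R →L[ℂ] H := (T : H →ₗ[ℂ] H).extendOfNorm e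
  refine ⟨V ∘L R.orthogonalProjectionOnto, ?_, ?_⟩
  · ext x
    have h1 : R.orthogonalProjectionOnto (P x) = e x :=
      Submodule.orthogonalProjectionOnto_mem_subspace_eq_self (K := R) ⟨P x, hR x⟩
    rw [comp_apply, comp_apply, h1]
    exact LinearMap.extendOfNorm_eq he ⟨1, hn⟩ x
  · have h1 : ‖V‖ ≤ 1 := LinearMap.opNorm_extendOfNorm_le he zero_le_one hn
    calc _ ≤ ‖V‖ * ‖R.orthogonalProjectionOnto‖ := opNorm_comp_le _ _
      _ ≤ 1 * 1 := by
        gcongr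
        exact R.orthogonalProjectionOnto_norm_le
      _ = 1 := one_mul 1

theorem norm_cfcAbs_apply (T : H →L[ℂ] H) (x : H) : ‖CFC.abs T x‖ = ‖T x‖ := by
  have h : CFC.abs T * CFC.abs T = star T * T := CFC.abs_mul_abs T
  have hs : adjoint (CFC.abs T) = CFC.abs T := (CFC.abs_nonneg T).isSelfAdjoint
  have h2 : (inner ℂ (CFC.abs T x) (CFC.abs T x)) = (inner ℂ (T x) (T x) : ℂ) := by
    rw [← adjoint_inner_right, ← adjoint_inner_right T, hs]
    have := congrArg (fun S : H →L[ℂ] H => inner ℂ x (S x)) h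
    simpa [star_eq_adjoint] using this
  rw [inner_self_eq_norm_sq_to_K, inner_self_eq_norm_sq_to_K] at h2
  have h3 : ‖CFC.abs T x‖ ^ 2 = ‖T x‖ ^ 2 := by exact_mod_cast h2
  exact (sq_eq_sq₀ (norm_nonneg _) (norm_nonneg _)).1 h3

/-- Polar decomposition. -/
theorem exists_polar_decomposition (T : H →L[ℂ] H) :
    ∃ U : H →L[ℂ] H, U ∘L CFC.abs T = T ∧ adjoint U ∘L T = CFC.abs T := by
  obtain ⟨U, hU, hU1⟩ := exists_contraction_comp_eq fun x => (norm_cfcAbs_apply T x).symm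
  refine ⟨U, hU, ?_⟩
  ext x
  rw [comp_apply, ← sub_eq_zero, ← norm_eq_zero]
  have hx : U (CFC.abs T x) = T x := congrArg (fun S : H →L[ℂ] H => S x) hU
  have h1 : ‖adjoint U (T x)‖ ≤ ‖T x‖ := by
    refine (le_opNorm _ _).trans ?_
    rw [LinearIsometryEquiv.norm_map]
    exact mul_le_of_le_one_left (norm_nonneg _) hU1
  -- The cross term is ⟨U⋆Tx, |T|x⟩ = ⟨Tx, U|T|x⟩ = ‖Tx‖², and neither vector is longer than ‖Tx‖,
  -- so the squared distance is at most zero. Only `‖U‖ ≤ 1` is needed.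
  have h2 := norm_sub_sq (𝕜 := ℂ) (adjoint U (T x)) (CFC.abs T x)
  rw [adjoint_inner_left, hx, inner_self_eq_norm_sq, norm_cfcAbs_apply] at h2
  have h3 : ‖adjoint U (T x) - CFC.abs T x‖ ^ 2 ≤ 0 := by
    rw [h2]
    nlinarith [norm_nonneg (adjoint U (T x)), norm_nonneg (T x)]
  exact pow_eq_zero_iff two_ne_zero |>.1 (le_antisymm h3 (sq_nonneg _))

/-- Writing |T| = U⋆T turns the diagonal coefficients of |T| into sums of ⟨A k U eᵢ, B k eᵢ⟩,
absolutely summable since A k U and B k are Hilbert-Schmidt. Treating a whole sum at once avoids a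
separate proof that trace class operators are closed under addition. -/
theorem isTraceClass_sum_adjoint_comp {ι : Type*} (s : Finset ι) (A B : ι → H →L[ℂ] H)
    (hA : ∀ k ∈ s, IsHilbertSchmidt (A k)) (hB : ∀ k ∈ s, IsHilbertSchmidt (B k)) :
    IsTraceClass (∑ k ∈ s, adjoint (A k) ∘L B k) := by
  set T := ∑ k ∈ s, adjoint (A k) ∘L B k with hT
  obtain ⟨U, -, hU⟩ := exists_polar_decomposition T
  rw [IsTraceClass, ← hU]
  have h : ∀ i, inner ℂ (basis H i) ((adjoint U ∘L T) (basis H i)) =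
      ∑ k ∈ s, inner ℂ ((A k ∘L U) (basis H i)) (B k (basis H i)) := fun i => by
    rw [comp_apply, adjoint_inner_right, hT, sum_apply, inner_sum]
    exact Finset.sum_congr rfl fun k _ => by rw [comp_apply, adjoint_inner_right, comp_apply]
  simp_rw [h]
  refine (Complex.hasSum_re (Summable.hasSum ?_)).summable
  exact summable_sum fun k hk => ((hA k hk).comp_right U).summable_inner (hB k hk)

theorem exists_adjoint_comp_self {T : H →L[ℂ] H} (hT : T.IsPositive) :
    ∃ A : H →L[ℂ] H, adjoint A = A ∧ adjoint A ∘L A = T := by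
  have h0 : 0 ≤ T := (nonneg_iff_isPositive T).2 hT
  have hs : adjoint (CFC.sqrt T) = CFC.sqrt T := (CFC.sqrt_nonneg T).isSelfAdjoint
  refine ⟨CFC.sqrt T, hs, ?_⟩
  rw [hs]
  exact CFC.sqrt_mul_sqrt_self T h0

theorem inner_adjoint_comp_self (A : H →L[ℂ] H) (x : H) :
    inner ℂ x ((adjoint A ∘L A) x) = ((‖A x‖ ^ 2 : ℝ) : ℂ) := by
  rw [comp_apply, adjoint_inner_right, inner_self_eq_norm_sq_to_K]
  norm_cast

/-- A trace class operator is a product of two Hilbert-Schmidt operators. -/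
theorem IsTraceClass.exists_eq_adjoint_comp {T : H →L[ℂ] H} (hT : IsTraceClass T) :
    ∃ A B : H →L[ℂ] H, IsHilbertSchmidt A ∧ IsHilbertSchmidt B ∧ T = adjoint A ∘L B := by
  obtain ⟨U, hU, -⟩ := exists_polar_decomposition T
  obtain ⟨S, hS, hST⟩ := exists_adjoint_comp_self
    ((nonneg_iff_isPositive _).1 (CFC.abs_nonneg T))
  -- With S = |T|^(1/2), ‖S eᵢ‖² = ⟨eᵢ, |T| eᵢ⟩; the factorization is then T = (U S) S.
  have hSHS : IsHilbertSchmidt S := by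
    refine .of_summable ?_
    rw [IsTraceClass, ← hST] at hT
    simpa only [inner_adjoint_comp_self, Complex.ofReal_re] using hT
  refine ⟨adjoint (U ∘L S), S, (hSHS.comp_left U).adjoint, hSHS, ?_⟩
  rw [adjoint_adjoint, comp_assoc]
  nth_rewrite 1 [← hS]
  rw [hST, hU]

/-- Over the fourth roots of unity, ∑ iᵏ and ∑ i²ᵏ vanish, so only the term A⋆B survives. -/
theorem adjoint_comp_polarization (A B : H →L[ℂ] H) :
    adjoint A ∘L B = ∑ k : Fin 4, (Complex.I ^ (k : ℕ) / 4) •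
      (adjoint (B + Complex.I ^ (k : ℕ) • A) ∘L (B + Complex.I ^ (k : ℕ) • A)) := by
  ext x
  refine ext_inner_left ℂ fun y => ?_
  simp only [Fin.sum_univ_four, add_apply, smul_apply, comp_apply, inner_add_right,
    inner_smul_right, adjoint_inner_right, inner_add_left, inner_smul_left]
  simp
  ring_nf
  simp
  ring

/-- A trace class operator is a linear combination of positive ones. -/
theorem IsTraceClass.exists_eq_sum {T : H →L[ℂ] H} (hT : IsTraceClass T) :
    ∃ (c : Fin 4 → ℂ) (C : Fin 4 → H →L[ℂ] H), (∀ k, IsHilbertSchmidt (C k)) ∧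
      T = ∑ k, c k • (adjoint (C k) ∘L C k) := by
  obtain ⟨A, B, hA, hB, rfl⟩ := hT.exists_eq_adjoint_comp
  exact ⟨_, _, fun k => hB.add (hA.smul _), adjoint_comp_polarization A B⟩

theorem trace_sum_adjoint_comp_self {ι : Type*} (s : Finset ι) (c : ι → ℂ) (C : ι → H →L[ℂ] H)
    (hC : ∀ k ∈ s, IsHilbertSchmidt (C k)) :
    trace (∑ k ∈ s, c k • (adjoint (C k) ∘L C k)) =
      ∑ k ∈ s, c k * ((∑' i, ‖C k (basis H i)‖ₑ ^ 2).toReal : ℂ) := by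
  have h : ∀ i, inner ℂ (basis H i) ((∑ k ∈ s, c k • (adjoint (C k) ∘L C k)) (basis H i)) =
      ∑ k ∈ s, c k * ((‖C k (basis H i)‖ ^ 2 : ℝ) : ℂ) := fun i => by
    rw [sum_apply, inner_sum]
    exact Finset.sum_congr rfl fun k _ => by
      rw [smul_apply, inner_smul_right, inner_adjoint_comp_self]
  simp_rw [trace, h]
  refine HasSum.tsum_eq (hasSum_sum fun k hk => HasSum.mul_left _ ?_)
  refine Complex.hasSum_ofReal.2 ?_
  have h1 := (ENNReal.hasSum_toReal (hC k hk))
  rw [← ENNReal.tsum_toReal_eq] at h1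
  · simpa using h1
  · intro i; simp

theorem isTraceClass_sum_adjoint_comp_self {ι : Type*} (s : Finset ι) (c : ι → ℂ)
    (C : ι → H →L[ℂ] H) (hC : ∀ k ∈ s, IsHilbertSchmidt (C k)) :
    IsTraceClass (∑ k ∈ s, c k • (adjoint (C k) ∘L C k)) := by
  simp_rw [← comp_smul]
  exact isTraceClass_sum_adjoint_comp s _ _ hC fun k hk => (hC k hk).smul _

end HilbertSchmidt

/-! ### Positive maps and the trace of positive operators -/

section PositiveMap

variable {H : Type*} [NormedAddCommGroup H] [InnerProductSpace ℂ H] [CompleteSpace H]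

open ContinuousLinearMap InnerProductSpace Filter Topology

/-- The trace, possibly infinite, of a positive operator. -/
def posTrace (T : H →L[ℂ] H) : ℝ≥0∞ :=
  ∑' i, ENNReal.ofReal (inner ℂ (basis H i) (T (basis H i))).re

theorem posTrace_adjoint_comp_self (A : H →L[ℂ] H) :
    posTrace (adjoint A ∘L A) = ∑' i, ‖A (basis H i)‖ₑ ^ 2 := by
  simp only [posTrace, inner_adjoint_comp_self, Complex.ofReal_re,
    ENNReal.ofReal_pow (norm_nonneg _), ofReal_norm]

theorem posTrace_rankOne_self (ξ : H) : posTrace (rankOne ℂ ξ ξ) = ‖ξ‖ₑ ^ 2 := by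
  rw [posTrace, ← tsum_enorm_inner_sq (basis H)]
  refine tsum_congr fun i => ?_
  rw [rankOne_apply, inner_smul_right, ← inner_conj_symm, RCLike.conj_mul]
  norm_cast
  change ENNReal.ofReal (‖_‖ ^ 2) = _
  rw [ENNReal.ofReal_pow (norm_nonneg _), ofReal_norm]

theorem isTraceClass_iff_posTrace {T : H →L[ℂ] H} (hT : T.IsPositive) :
    IsTraceClass T ↔ posTrace T ≠ ∞ := by
  have h0 : ∀ i, 0 ≤ (inner ℂ (basis H i) (T (basis H i))).re := fun i =>
    hT.re_inner_nonneg_right _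
  rw [IsTraceClass, CFC.abs_of_nonneg T ((nonneg_iff_isPositive T).2 hT), posTrace]
  refine ⟨fun h => ?_, fun h => ?_⟩
  · rw [← ENNReal.ofReal_tsum_of_nonneg h0 h]
    exact ENNReal.ofReal_ne_top
  · simpa [ENNReal.toReal_ofReal (h0 _)] using ENNReal.summable_toReal h

theorem trace_eq_posTrace {T : H →L[ℂ] H} (hT : T.IsPositive) (hT' : posTrace T ≠ ∞) :
    trace T = (posTrace T).toReal := by
  obtain ⟨A, -, rfl⟩ := exists_adjoint_comp_self hT
  rw [posTrace_adjoint_comp_self] at hT' ⊢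
  simpa using trace_sum_adjoint_comp_self {()} (fun _ => 1) (fun _ => A) fun _ _ => hT'

/-- Parseval for `A x`: the quadratic form of A⋆A = ∑ᵢ |A⋆eᵢ⟩⟨A⋆eᵢ|. -/
theorem hasSum_norm_inner_sq (A : H →L[ℂ] H) (x : H) :
    HasSum (fun i => ‖inner ℂ (adjoint A (basis H i)) x‖ ^ 2) (‖A x‖ ^ 2) := by
  have h := tsum_enorm_inner_sq (basis H) (A x)
  simp_rw [← adjoint_inner_left] at h
  have hfin : ∑' i, ‖inner ℂ (adjoint A (basis H i)) x‖ₑ ^ 2 ≠ ∞ := by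
    rw [h]
    simp
  have h1 := ENNReal.hasSum_toReal hfin
  rw [← ENNReal.tsum_toReal_eq (by simp), h] at h1
  simpa using h1

/-- A positive map is determined on a positive trace class operator `A⋆ A = ∑ᵢ |A⋆ eᵢ⟩⟨A⋆ eᵢ|` by
its values on rank one operators. -/
theorem IsPositiveMap.hasSum_re_inner {M : (H →L[ℂ] H) →ₗ[ℂ] (H →L[ℂ] H)} (hM : IsPositiveMap M)
    {A : H →L[ℂ] H} (hA : IsHilbertSchmidt A) (η : H) :
    HasSum (fun i => (inner ℂ η (M (rankOne ℂ (adjoint A (basis H i))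
      (adjoint A (basis H i))) η)).re) (inner ℂ η (M (adjoint A ∘L A) η)).re := by
  let q : (H →L[ℂ] H) → ℝ := fun S => (inner ℂ η (M S η)).re
  let R : basisIndex H → (H →L[ℂ] H) := fun i =>
    rankOne ℂ (adjoint A (basis H i)) (adjoint A (basis H i))
  let T := adjoint A ∘L A
  let s : ℝ := ∑' i, ‖adjoint A (basis H i)‖ ^ 2
  have hs : HasSum (fun i => ‖adjoint A (basis H i)‖ ^ 2) s := hA.adjoint.summable.hasSum
  have hT : IsSelfAdjoint T := (isPositive_adjoint_comp_self A).isSelfAdjoint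
  have hR : ∀ F : Finset (basisIndex H), IsSelfAdjoint (∑ i ∈ F, R i) := fun F =>
    (isPositive_sum F fun i _ => isPositive_rankOne_self _).isSelfAdjoint
  have hTx : ∀ x, (inner ℂ (T x) x).re = ‖A x‖ ^ 2 := fun x => by
    rw [← inner_conj_symm, inner_adjoint_comp_self, Complex.conj_ofReal, Complex.ofReal_re]
  have hRx : ∀ F : Finset (basisIndex H), ∀ x, (inner ℂ ((∑ i ∈ F, R i) x) x).re =
      ∑ i ∈ F, ‖inner ℂ (adjoint A (basis H i)) x‖ ^ 2 := fun F x => by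
    rw [sum_apply, sum_inner, Complex.re_sum]
    refine Finset.sum_congr rfl fun i _ => ?_
    rw [rankOne_apply, inner_smul_left, RCLike.conj_mul]
    norm_cast
  have hle : ∀ F : Finset (basisIndex H), (T - ∑ i ∈ F, R i).IsPositive := fun F => by
    refine isPositive_def'.2 ⟨hT.sub (hR F), fun x => ?_⟩
    rw [reApplyInnerSelf_apply, sub_apply, inner_sub_left, map_sub]
    change 0 ≤ (inner ℂ (T x) x).re - (inner ℂ ((∑ i ∈ F, R i) x) x).re
    rw [hTx, hRx, sub_nonneg]
    exact sum_le_hasSum F (fun i _ => by positivity) (hasSum_norm_inner_sq A x)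
  -- By Cauchy-Schwarz the remainder of the rank one expansion is at most the tail of ∑ ‖A⋆eᵢ‖²
  -- times the identity. Applying the positive map to both bounds squeezes the error between 0 and
  -- the tail times ⟨η, M(1) η⟩, so positivity alone gives convergence.
  have hge : ∀ F : Finset (basisIndex H), (((s - ∑ i ∈ F, ‖adjoint A (basis H i)‖ ^ 2 : ℝ) : ℂ) •
      (1 : H →L[ℂ] H) - (T - ∑ i ∈ F, R i)).IsPositive := fun F => by
    refine isPositive_def'.2 ⟨IsSelfAdjoint.sub ?_ (hT.sub (hR F)), fun x => ?_⟩
    · exact IsSelfAdjoint.smul (Complex.conj_ofReal _) (IsSelfAdjoint.one _)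
    rw [reApplyInnerSelf_apply, sub_apply, sub_apply, inner_sub_left, inner_sub_left, map_sub,
      map_sub]
    change 0 ≤ (inner ℂ _ x).re - ((inner ℂ (T x) x).re - (inner ℂ ((∑ i ∈ F, R i) x) x).re)
    have h1 := sum_le_hasSum F (fun i _ => ?_)
      ((hs.mul_right (‖x‖ ^ 2)).sub (hasSum_norm_inner_sq A x))
    · rw [hTx, hRx, smul_apply, inner_smul_left, Complex.conj_ofReal, one_apply_eq_self,
        inner_self_eq_norm_sq_to_K, Complex.re_ofReal_mul]
      norm_cast
      rw [Finset.sum_sub_distrib, ← Finset.sum_mul] at h1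
      simp only [Complex.ofReal_re, Complex.coe_algebraMap]
      linarith
    · rw [sub_nonneg, ← mul_pow]
      exact pow_le_pow_left₀ (norm_nonneg _) (norm_inner_le_norm _ _) 2
  have hq : ∀ F : Finset (basisIndex H), q (T - ∑ i ∈ F, R i) = q T - ∑ i ∈ F, q (R i) :=
    fun F => by simp [q, sum_apply]
  have h1 : ∀ F : Finset (basisIndex H), 0 ≤ q T - ∑ i ∈ F, q (R i) := fun F => by
    rw [← hq]
    exact (hM _ (hle F)).re_inner_nonneg_right η
  have h2 : ∀ F : Finset (basisIndex H), q T - ∑ i ∈ F, q (R i) ≤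
      (s - ∑ i ∈ F, ‖adjoint A (basis H i)‖ ^ 2) * q 1 := fun F => by
    have h := (hM _ (hge F)).re_inner_nonneg_right η
    rw [map_sub, sub_apply, inner_sub_right, map_sub, map_smul, smul_apply, inner_smul_right] at h
    change 0 ≤ (_ * _ : ℂ).re - q (T - ∑ i ∈ F, R i) at h
    rw [hq, Complex.re_ofReal_mul] at h
    linarith
  have h3 : Tendsto (fun F : Finset (basisIndex H) =>
      (s - ∑ i ∈ F, ‖adjoint A (basis H i)‖ ^ 2) * q 1) atTop (𝓝 0) := by
    have := (tendsto_const_nhds (x := s)).sub hs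
    simpa using this.mul_const (q 1)
  have h4 := squeeze_zero h1 h2 h3
  have h5 := (tendsto_const_nhds (x := q T)).sub h4
  simp only [sub_sub_cancel, sub_zero] at h5
  exact h5

theorem IsPositiveMap.posTrace_adjoint_comp_self {M : (H →L[ℂ] H) →ₗ[ℂ] (H →L[ℂ] H)}
    (hM : IsPositiveMap M) {A : H →L[ℂ] H} (hA : IsHilbertSchmidt A) :
    posTrace (M (adjoint A ∘L A)) =
      ∑' i, posTrace (M (rankOne ℂ (adjoint A (basis H i)) (adjoint A (basis H i)))) := by
  simp only [posTrace]
  rw [ENNReal.tsum_comm]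
  refine tsum_congr fun j => ?_
  have h := hM.hasSum_re_inner hA (basis H j)
  rw [← h.tsum_eq]
  exact ENNReal.ofReal_tsum_of_nonneg
    (fun i => (hM _ (isPositive_rankOne_self _)).re_inner_nonneg_right _) h.summable

/-- A positive map is trace preserving if and only if it preserves the trace of the positive
operators of rank one. -/
theorem IsPositiveMap.isTracePreserving_iff {M : (H →L[ℂ] H) →ₗ[ℂ] (H →L[ℂ] H)}
    (hM : IsPositiveMap M) :
    IsTracePreserving M ↔ ∀ ξ : H, posTrace (M (rankOne ℂ ξ ξ)) = ‖ξ‖ₑ ^ 2 := by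
  refine ⟨fun h ξ => ?_, fun h T hT => ?_⟩
  · have hξ : (rankOne ℂ ξ ξ).IsPositive := isPositive_rankOne_self ξ
    have hfin : posTrace (rankOne ℂ ξ ξ) ≠ ∞ := by
      rw [posTrace_rankOne_self]
      simp
    obtain ⟨h1, h2⟩ := h _ ((isTraceClass_iff_posTrace hξ).2 hfin)
    have hfin' := (isTraceClass_iff_posTrace (hM _ hξ)).1 h1
    rw [trace_eq_posTrace (hM _ hξ) hfin', trace_eq_posTrace hξ hfin] at h2
    rw [← posTrace_rankOne_self]
    exact (ENNReal.toReal_eq_toReal_iff' hfin' hfin).1 (by exact_mod_cast h2)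
  · obtain ⟨c, C, hC, rfl⟩ := hT.exists_eq_sum
    -- Square roots of the positive operators M(C⋆C): preservation of the trace becomes equality of
    -- Hilbert-Schmidt norms of D and C.
    choose D _ hD using fun k => exists_adjoint_comp_self
      (hM _ (isPositive_adjoint_comp_self (C k)))
    have hCD : ∀ k, ∑' i, ‖D k (basis H i)‖ₑ ^ 2 = ∑' i, ‖C k (basis H i)‖ₑ ^ 2 := fun k => by
      rw [← SchurMult.posTrace_adjoint_comp_self, hD, hM.posTrace_adjoint_comp_self (hC k)]
      simp_rw [h]
      exact (tsum_enorm_sq_adjoint _ _ _).symm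
    have hDHS : ∀ k, IsHilbertSchmidt (D k) := fun k => by
      rw [IsHilbertSchmidt, hCD]
      exact hC k
    simp_rw [map_sum, map_smul, ← hD]
    refine ⟨isTraceClass_sum_adjoint_comp_self _ _ _ fun k _ => hDHS k, ?_⟩
    rw [trace_sum_adjoint_comp_self _ _ _ fun k _ => hDHS k,
      trace_sum_adjoint_comp_self _ _ _ fun k _ => hC k]
    simp_rw [hCD]

end PositiveMap

/-! ### Values of a Schur multiplier on rank one operators -/

section RankOne

open InnerProductSpace ComplexConjugate

variable {X : Type*} [MeasurableSpace X] {μ : Measure X}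

theorem memLp_mul_conj [SFinite μ] {f g : X → ℂ} (hf : MemLp f 2 μ) (hg : MemLp g 2 μ) :
    MemLp (fun z : X × X => f z.1 * conj (g z.2)) 2 (μ.prod μ) := by
  have hm : AEStronglyMeasurable (fun z : X × X => f z.1 * conj (g z.2)) (μ.prod μ) :=
    hf.1.comp_fst.mul (Complex.continuous_conj.comp_aestronglyMeasurable hg.1.comp_snd)
  rw [memLp_two_iff_integrable_sq_norm hm]
  simp only [norm_mul, mul_pow, RCLike.norm_conj]
  exact ((memLp_two_iff_integrable_sq_norm hf.1).1 hf).mul_prod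
    ((memLp_two_iff_integrable_sq_norm hg.1).1 hg)

variable [SigmaFinite μ]

theorem kernelOp_coeFn {f : X × X → ℂ} (hf : MemLp f 2 (μ.prod μ)) (ξ : Lp ℂ 2 μ) :
    kernelOp μ f hf ξ =ᵐ[μ] kernelFun μ f ξ :=
  MemLp.coeFn_toLp (memLp_kernelFun hf (Lp.memLp ξ))

theorem kernelOp_mul_conj (ξ η : Lp ℂ 2 μ) :
    kernelOp μ (fun z => ξ z.1 * conj (η z.2)) (memLp_mul_conj (Lp.memLp ξ) (Lp.memLp η)) =
      rankOne ℂ ξ η := by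
  ext1 ζ
  refine Lp.ext ?_
  rw [rankOne_apply]
  filter_upwards [kernelOp_coeFn (memLp_mul_conj (Lp.memLp ξ) (Lp.memLp η)) ζ,
    Lp.coeFn_smul (inner ℂ η ζ) ξ] with x hx hx'
  rw [hx, hx', Pi.smul_apply, kernelFun, L2.inner_def, smul_eq_mul, mul_comm (∫ _, _ ∂μ),
    ← integral_const_mul]
  simp only [RCLike.inner_apply', mul_assoc]

/-- The sesquilinear form of `M_φ(|ξ⟩⟨ξ|)`. -/
theorem IsSchurMultiplier.inner_rankOne {φ : X × X → ℂ}
    {M : (Lp ℂ 2 μ →L[ℂ] Lp ℂ 2 μ) →ₗ[ℂ] (Lp ℂ 2 μ →L[ℂ] Lp ℂ 2 μ)}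
    (hM : IsSchurMultiplier μ φ M) (ξ η ζ : Lp ℂ 2 μ) :
    inner ℂ η (M (rankOne ℂ ξ ξ) ζ) =
      ∫ x, conj (η x) * ξ x * ∫ y, φ (x, y) * (conj (ξ y) * ζ y) ∂μ ∂μ := by
  obtain ⟨hφ, -, -, h⟩ := hM
  rw [← kernelOp_mul_conj, h, L2.inner_def]
  refine integral_congr_ae ?_
  filter_upwards [kernelOp_coeFn (memLp_mul hφ (memLp_mul_conj (Lp.memLp ξ) (Lp.memLp ξ))) ζ]
    with x hx
  rw [hx, kernelFun, RCLike.inner_apply', mul_assoc (conj (η x)) (ξ x)]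
  congr 1
  rw [← integral_const_mul]
  refine integral_congr_ae (Filter.Eventually.of_forall fun y => ?_)
  simp only
  ring

end RankOne

/-! ### Positive definiteness of the symbol -/

universe u

section PositiveDefinite

open InnerProductSpace ComplexConjugate

/-- Kolmogorov decomposition of a positive definite kernel. -/
theorem exists_inner_eq_of_posDef {X : Type u} (φ : X → X → ℂ)
    (hφ : ∀ x y, conj (φ x y) = φ y x)
    (hpos : ∀ a : X →₀ ℂ, 0 ≤ (a.sum fun x w => a.sum fun y w' => conj w * w' * φ x y).re) :
    ∃ (V : Type u) (_ : NormedAddCommGroup V) (_ : InnerProductSpace ℂ V) (_ : CompleteSpace V)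
      (v : X → V), ∀ x y, inner ℂ (v x) (v y) = φ x y := by
  -- The scalar kernel is viewed as operator-valued on ℂ; the vectors sought are the kernel
  -- functions of its reproducing kernel Hilbert space.
  let K : Matrix X X (ℂ →L[ℂ] ℂ) := Matrix.of fun x y => φ x y • 1
  have hK : K.PosSemidef := by
    have h := (RKHS.posSemidef_tfae (K := K)).out 0 2
    refine h.2 ⟨?_, fun a => ?_⟩
    · ext x y
      simp [K, hφ]
    · have hterm : ∀ x y w w', inner ℂ (K y x w) w' = conj w * w' * φ x y := fun x y w w' => by
        simp only [K, Matrix.of_apply, smul_apply, one_apply_eq_self, RCLike.inner_apply',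
          smul_eq_mul, map_mul, hφ]
        ring
      simp_rw [hterm]
      exact hpos a
  have : Fact K.PosSemidef := ⟨hK⟩
  refine ⟨RKHS.OfKernel K, inferInstance, inferInstance, inferInstance,
    fun x => RKHS.kerFun (RKHS.OfKernel K) x 1, fun x y => ?_⟩
  rw [← RKHS.kernel_inner, RKHS.OfKernel.kernel_ofKernel]
  simp [K, hφ]

theorem integral_mul_indicator_inv {X : Type*} [MeasurableSpace X] {μ : Measure X}
    {U : Set X} (hU : MeasurableSet U) (g : X → ℂ) :
    ∫ u, g u * U.indicator (fun _ => (((μ.real U)⁻¹ : ℝ) : ℂ)) u ∂μ = ⨍ u in U, g u ∂μ := by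
  simp_rw [← Set.indicator_mul_right]
  rw [integral_indicator hU, integral_mul_const, setAverage_eq, Complex.real_smul, mul_comm]

variable {X : Type*} [TopologicalSpace X] [MeasurableSpace X]
  {μ : Measure X} [SigmaFinite μ] [μ.IsOpenPosMeasure]

/-- The essential bound holds everywhere, since it fails on an open null set and μ × μ has full
support. -/
theorem exists_bound_of_memLp_top {φ : X × X → ℂ} (hφc : Continuous φ)
    (hφ : MemLp φ ∞ (μ.prod μ)) : ∃ C : ℝ, ∀ z, ‖φ z‖ ≤ C := by
  refine ⟨(eLpNorm φ ∞ (μ.prod μ)).toReal, fun z => ?_⟩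
  have h : ∀ᵐ z ∂μ.prod μ, ‖φ z‖ ≤ (eLpNorm φ ∞ (μ.prod μ)).toReal := by
    filter_upwards [ae_le_eLpNormEssSup (f := φ) (μ := μ.prod μ)] with z hz
    rw [← toReal_enorm]
    exact ENNReal.toReal_mono hφ.2.ne (by simpa using hz)
  have ho : IsOpen {z | ¬ ‖φ z‖ ≤ (eLpNorm φ ∞ (μ.prod μ)).toReal} := by
    simp only [not_le]
    exact isOpen_lt continuous_const hφc.norm
  have he := ho.eq_empty_of_measure_zero (μ := μ.prod μ) h
  by_contra hz
  exact (Set.mem_empty_iff_false z).1 (he ▸ hz)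

variable [BorelSpace X] [IsLocallyFiniteMeasure μ]

/-- The values of `φ` on a finite set are approximated by matrix coefficients of a single operator
in the range of the Schur multiplier. -/
theorem IsSchurMultiplier.exists_approx {φ : X × X → ℂ} (hφ : Continuous φ)
    {M : (Lp ℂ 2 μ →L[ℂ] Lp ℂ 2 μ) →ₗ[ℂ] (Lp ℂ 2 μ →L[ℂ] Lp ℂ 2 μ)}
    (hM : IsSchurMultiplier μ φ M) (s : Finset X) {ε : ℝ} (hε : 0 < ε) :
    ∃ (ξ : Lp ℂ 2 μ) (χ : X → Lp ℂ 2 μ), ∀ x ∈ s, ∀ y ∈ s,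
      ‖inner ℂ (χ x) (M (rankOne ℂ ξ ξ) (χ y)) - φ (x, y)‖ ≤ ε := by
  have hnear : ∀ x y : X, ∃ A B : Set X, IsOpen A ∧ x ∈ A ∧ IsOpen B ∧ y ∈ B ∧
      A ×ˢ B ⊆ φ ⁻¹' Metric.ball (φ (x, y)) ε := fun x y => by
    obtain ⟨A, B, hA, hB, hx, hy, hAB⟩ := isOpen_prod_iff.1
      (Metric.isOpen_ball.preimage hφ) x y (Metric.mem_ball_self hε)
    exact ⟨A, B, hA, hx, hB, hy, hAB⟩
  choose A B hA hxA hB hyB hAB using hnear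
  choose N hxN hN hμN using fun x : X => μ.exists_isOpen_measure_lt_top x
  -- A neighbourhood of x that serves as first factor and as second factor against every point of
  -- `s`, cut down to finite measure.
  let U : X → Set X := fun x => N x ∩ ⋂ p ∈ s, (A x p ∩ B p x)
  have hUo : ∀ x, IsOpen (U x) := fun x =>
    (hN x).inter (isOpen_biInter_finset fun p _ => (hA x p).inter (hB p x))
  have hUm : ∀ x, MeasurableSet (U x) := fun x => (hUo x).measurableSet
  have hUμ : ∀ x, μ (U x) ≠ ∞ := fun x =>
    ((measure_mono Set.inter_subset_left).trans_lt (hμN x)).ne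
  have hxU : ∀ x, x ∈ U x := fun x =>
    ⟨hxN x, Set.mem_iInter₂.2 fun p _ => ⟨hxA x p, hyB p x⟩⟩
  have hU0 : ∀ x, μ (U x) ≠ 0 := fun x => (hUo x).measure_ne_zero μ ⟨x, hxU x⟩
  have hUU : ∀ x ∈ s, ∀ y ∈ s, ∀ t ∈ U x, ∀ u ∈ U y, φ (t, u) ∈ Metric.closedBall (φ (x, y)) ε :=
    fun x hx y hy t ht u hu => Metric.ball_subset_closedBall <| @hAB x y (t, u)
      ⟨(Set.mem_iInter₂.1 ht.2 y hy).1, (Set.mem_iInter₂.1 hu.2 x hx).2⟩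
  let W : Set X := ⋃ x ∈ s, U x
  have hWm : MeasurableSet W := s.measurableSet_biUnion fun x _ => hUm x
  have hWμ : μ W ≠ ∞ := (measure_biUnion_lt_top s.finite_toSet fun x _ => (hUμ x).lt_top).ne
  -- Since ξ is 1 on every `U x` with x ∈ s, multiplying by it does not change the normalized
  -- indicator `χ x`; the matrix coefficients become averages of φ over `U x × U y`, which lie
  -- within ε of φ(x,y) by convexity of the closed ball.
  let ξ : Lp ℂ 2 μ := indicatorConstLp 2 hWm hWμ 1
  let χ : X → Lp ℂ 2 μ := fun x => indicatorConstLp 2 (hUm x) (hUμ x) (((μ.real (U x))⁻¹ : ℝ) : ℂ)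
  have hχ : ∀ x ∈ s, ∀ᵐ t ∂μ, conj (ξ t) * χ x t =
      (U x).indicator (fun _ => (((μ.real (U x))⁻¹ : ℝ) : ℂ)) t := fun x hx => by
    filter_upwards [indicatorConstLp_coeFn (p := 2) (hs := hWm) (hμs := hWμ) (c := (1 : ℂ)),
      indicatorConstLp_coeFn (p := 2) (hs := hUm x) (hμs := hUμ x)
        (c := (((μ.real (U x))⁻¹ : ℝ) : ℂ))] with t h1 h2
    simp only [ξ, χ]
    rw [h1, h2]
    by_cases ht : t ∈ U x
    · have : t ∈ W := Set.mem_biUnion hx ht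
      simp [this]
    · simp [ht]
  obtain ⟨hφ', -⟩ := id hM
  obtain ⟨C, hC⟩ := exists_bound_of_memLp_top hφ hφ'
  refine ⟨ξ, χ, fun x hx y hy => ?_⟩
  have hval : inner ℂ (χ x) (M (rankOne ℂ ξ ξ) (χ y)) =
      ⨍ t in U x, ⨍ u in U y, φ (t, u) ∂μ ∂μ := by
    rw [hM.inner_rankOne, ← integral_mul_indicator_inv (hUm x)]
    refine integral_congr_ae ?_
    filter_upwards [hχ x hx] with t ht
    rw [← integral_mul_indicator_inv (hUm y), mul_comm]
    congr 1
    · refine integral_congr_ae ?_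
      filter_upwards [hχ y hy] with u hu
      rw [hu]
    · have h1 := congrArg conj ht
      rw [map_mul, Complex.conj_conj, mul_comm] at h1
      rw [h1]
      by_cases h : t ∈ U x <;> simp [h]
  have hint : ∀ t, IntegrableOn (fun u => φ (t, u)) (U y) μ := fun t =>
    Measure.integrableOn_of_bounded (M := C) (hUμ y)
      (hφ.comp (by fun_prop : Continuous fun u => (t, u))).measurable.aestronglyMeasurable
      (Filter.Eventually.of_forall fun u => hC _)
  have hball : ∀ t ∈ U x, ⨍ u in U y, φ (t, u) ∂μ ∈ Metric.closedBall (φ (x, y)) ε := fun t ht =>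
    (convex_closedBall _ _).set_average_mem Metric.isClosed_closedBall (hU0 y) (hUμ y)
      ((ae_restrict_mem (hUm y)).mono fun u hu => hUU x hx y hy t ht u hu) (hint t)
  -- The product σ-algebra may be smaller than the Borel one on X × X, so joint measurability is
  -- taken from `hφ'` rather than from continuity.
  have hmeas : AEStronglyMeasurable (fun t => ⨍ u in U y, φ (t, u) ∂μ) μ := by
    simp_rw [← integral_mul_indicator_inv (hUm y)]
    exact AEStronglyMeasurable.integral_prod_right' (f := fun z : X × X => φ z *
      (U y).indicator (fun _ => (((μ.real (U y))⁻¹ : ℝ) : ℂ)) z.2)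
      (hφ'.1.mul (measurable_const.indicator (hUm y)).aestronglyMeasurable.comp_snd)
  have hmem := (convex_closedBall (φ (x, y)) ε).set_average_mem Metric.isClosed_closedBall
    (hU0 x) (hUμ x) ((ae_restrict_mem (hUm x)).mono hball)
    (Measure.integrableOn_of_bounded (M := ‖φ (x, y)‖ + ε) (hUμ x) hmeas
      ((ae_restrict_mem (hUm x)).mono fun t ht => norm_le_norm_add_const_of_dist_le (hball t ht)))
  rw [hval, ← dist_eq_norm]
  exact hmem

/-- One positive, hence self-adjoint, operator approximates both φ(x,y) and φ(y,x). -/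
theorem IsSchurMultiplier.conj_symm {φ : X × X → ℂ} (hφ : Continuous φ)
    {M : (Lp ℂ 2 μ →L[ℂ] Lp ℂ 2 μ) →ₗ[ℂ] (Lp ℂ 2 μ →L[ℂ] Lp ℂ 2 μ)}
    (hM : IsSchurMultiplier μ φ M) (hpos : IsPositiveMap M) (x y : X) :
    conj (φ (x, y)) = φ (y, x) := by
  classical
  refine eq_of_forall_dist_le fun ε hε => ?_
  obtain ⟨ξ, χ, h⟩ := hM.exists_approx hφ {x, y} (half_pos hε)
  have h1 := h x (by simp) y (by simp)
  have h2 := h y (by simp) x (by simp)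
  have hs : inner ℂ (χ y) (M (rankOne ℂ ξ ξ) (χ x)) =
      conj (inner ℂ (χ x) (M (rankOne ℂ ξ ξ) (χ y))) := by
    rw [inner_conj_symm]
    exact ((hpos _ (isPositive_rankOne_self ξ)).inner_left_eq_inner_right _ _).symm
  rw [← RCLike.norm_conj, map_sub, ← hs, ← dist_eq_norm] at h1
  rw [← dist_eq_norm] at h2
  linarith [dist_triangle_left (conj (φ (x, y))) (φ (y, x))
    (inner ℂ (χ y) (M (rankOne ℂ ξ ξ) (χ x)))]

theorem IsSchurMultiplier.re_sum_nonneg {φ : X × X → ℂ} (hφ : Continuous φ)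
    {M : (Lp ℂ 2 μ →L[ℂ] Lp ℂ 2 μ) →ₗ[ℂ] (Lp ℂ 2 μ →L[ℂ] Lp ℂ 2 μ)}
    (hM : IsSchurMultiplier μ φ M) (hpos : IsPositiveMap M) (a : X →₀ ℂ) :
    0 ≤ (a.sum fun x w => a.sum fun y w' => conj w * w' * φ (x, y)).re := by
  set S : ℝ := ∑ x ∈ a.support, ∑ y ∈ a.support, ‖conj (a x) * a y‖ with hS
  have hS0 : 0 ≤ S := by positivity
  refine le_of_forall_pos_le_add fun δ hδ => ?_
  have hε : 0 < δ / (S + 1) := by positivity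
  obtain ⟨ξ, χ, h⟩ := hM.exists_approx hφ a.support hε
  set K := M (rankOne ℂ ξ ξ)
  -- The quadratic form of the positive operator K at this vector approximates the kernel sum to
  -- within S δ / (S + 1) ≤ δ; the `+ 1` covers S = 0.
  let η := ∑ x ∈ a.support, a x • χ x
  have h0 : 0 ≤ (inner ℂ η (K η)).re :=
    (hpos _ (isPositive_rankOne_self ξ)).re_inner_nonneg_right η
  have h1 : inner ℂ η (K η) =
      ∑ x ∈ a.support, ∑ y ∈ a.support, conj (a x) * a y * inner ℂ (χ x) (K (χ y)) := by
    simp only [η, map_sum, sum_inner, inner_sum, map_smul, inner_smul_left, inner_smul_right,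
      Finset.mul_sum]
    rw [Finset.sum_comm]
    exact Finset.sum_congr rfl fun x _ => Finset.sum_congr rfl fun y _ => by ring
  have h2 : ‖inner ℂ η (K η) - a.sum fun x w => a.sum fun y w' => conj w * w' * φ (x, y)‖ ≤ δ := by
    simp only [h1, Finsupp.sum, ← Finset.sum_sub_distrib, ← mul_sub]
    calc _ ≤ ∑ x ∈ a.support, ∑ y ∈ a.support, ‖conj (a x) * a y‖ * (δ / (S + 1)) := by
          refine norm_sum_le_of_le _ fun x hx => norm_sum_le_of_le _ fun y hy => ?_
          rw [norm_mul]
          exact mul_le_mul_of_nonneg_left (h x hx y hy) (norm_nonneg _)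
      _ = S * (δ / (S + 1)) := by simp only [hS, Finset.sum_mul]
      _ ≤ δ := by
          rw [mul_div_assoc', div_le_iff₀ (by positivity)]
          nlinarith
  have h3 := (Complex.abs_re_le_norm _).trans h2
  rw [Complex.sub_re] at h3
  linarith [(abs_le.1 h3).2]

end PositiveDefinite

/-! ### Parseval's identity for vector-valued functions -/

section Parseval

open TopologicalSpace

/-- Distinct basis vectors are √2 apart, so balls of radius 1/2 around them are disjoint. -/
theorem countable_of_hilbertBasis {V κ : Type*} [NormedAddCommGroup V] [InnerProductSpace ℂ V]
    [SeparableSpace V] (b : HilbertBasis κ ℂ V) : Countable κ := by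
  have hdist : ∀ i j, i ≠ j → 1 < dist (b i) (b j) := fun i j hij => by
    have h := norm_sub_sq (𝕜 := ℂ) (b i) (b j)
    rw [b.orthonormal.inner_eq_zero hij, b.orthonormal.norm_eq_one, b.orthonormal.norm_eq_one] at h
    rw [dist_eq_norm]
    norm_num at h
    nlinarith [norm_nonneg (b i - b j)]
  have hd : Pairwise (Function.onFun Disjoint fun i => Metric.ball (b i) (1 / 2)) :=
    fun i j hij => Metric.ball_disjoint_ball (by linarith [hdist i j hij])
  have := Set.PairwiseDisjoint.countable_of_isOpen (a := Set.univ) (fun i _ j _ hij => hd hij)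
    (fun i _ => Metric.isOpen_ball) (fun i _ => ⟨b i, Metric.mem_ball_self (by norm_num)⟩)
  exact Set.countable_univ_iff.1 this

variable {X : Type*} [MeasurableSpace X] {μ : Measure X}
  {V : Type*} [NormedAddCommGroup V] [InnerProductSpace ℂ V] [CompleteSpace V]

theorem enorm_sq_eq_lintegral (ξ : Lp ℂ 2 μ) : ‖ξ‖ₑ ^ 2 = ∫⁻ x, ‖ξ x‖ₑ ^ 2 ∂μ := by
  rw [Lp.enorm_def, eLpNorm_two_sq]

/-- Parseval for `e` is applied to each coordinate of w in a basis of V, then Parseval for that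
basis pointwise. Separability makes the basis countable, so that sum and integral commute. -/
theorem tsum_enorm_integral_smul_sq_of_separable [SeparableSpace V] {ι : Type*}
    (e : HilbertBasis ι ℂ (Lp ℂ 2 μ)) {w : X → V} (hw : MemLp w 2 μ) :
    ∑' i, ‖∫ x, e i x • w x ∂μ‖ₑ ^ 2 = ∫⁻ x, ‖w x‖ₑ ^ 2 ∂μ := by
  obtain ⟨κ, b, -⟩ := exists_hilbertBasis ℂ V
  have : Countable κ := countable_of_hilbertBasis b
  -- The conjugated coordinates, because the integral contains `e i` while the inner product of L²
  -- conjugates it.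
  let g : κ → Lp ℂ 2 μ := fun k => (hw.inner_const (𝕜 := ℂ) (b k)).toLp
  have hg : ∀ k, g k =ᵐ[μ] fun x => inner ℂ (w x) (b k) := fun k => MemLp.coeFn_toLp _
  have hint : ∀ i, Integrable (fun x => e i x • w x) μ := fun i =>
    memLp_one_iff_integrable.1 (hw.smul (Lp.memLp (e i)))
  have hinner : ∀ i k, inner ℂ (e i) (g k) = inner ℂ (∫ x, e i x • w x ∂μ) (b k) := fun i k => by
    rw [← inner_conj_symm _ (b k), ← integral_inner (hint i), ← integral_conj, L2.inner_def]
    refine integral_congr_ae ?_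
    filter_upwards [hg k] with x hx
    rw [hx, inner_conj_symm, inner_smul_left, RCLike.inner_apply']
  calc ∑' i, ‖∫ x, e i x • w x ∂μ‖ₑ ^ 2
      = ∑' i, ∑' k, ‖inner ℂ (e i) (g k)‖ₑ ^ 2 := by
        refine tsum_congr fun i => ?_
        rw [← tsum_enorm_inner_sq b]
        refine tsum_congr fun k => ?_
        rw [hinner, ← inner_conj_symm, RCLike.enorm_conj]
    _ = ∑' k, ‖g k‖ₑ ^ 2 := by
        rw [ENNReal.tsum_comm]
        exact tsum_congr fun k => tsum_enorm_inner_sq e (g k)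
    _ = ∑' k, ∫⁻ x, ‖inner ℂ (b k) (w x)‖ₑ ^ 2 ∂μ := by
        refine tsum_congr fun k => ?_
        rw [enorm_sq_eq_lintegral]
        refine lintegral_congr_ae ?_
        filter_upwards [hg k] with x hx
        rw [hx, ← inner_conj_symm, RCLike.enorm_conj]
    _ = ∫⁻ x, ‖w x‖ₑ ^ 2 ∂μ := by
        rw [← lintegral_tsum fun k => ((hw.1.const_inner (𝕜 := ℂ)).enorm.pow_const 2)]
        exact lintegral_congr fun x => tsum_enorm_inner_sq b (w x)

/-- A strongly measurable w takes almost all its values in a separable closed subspace, to which the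
separable case applies. -/
theorem tsum_enorm_integral_smul_sq {ι : Type*} (e : HilbertBasis ι ℂ (Lp ℂ 2 μ)) {w : X → V}
    (hw : MemLp w 2 μ) :
    ∑' i, ‖∫ x, e i x • w x ∂μ‖ₑ ^ 2 = ∫⁻ x, ‖w x‖ₑ ^ 2 ∂μ := by
  obtain ⟨w', hw', hww'⟩ := hw.1
  let S : Submodule ℂ V := (Submodule.span ℂ (Set.range w')).topologicalClosure
  have : CompleteSpace S := (Submodule.isClosed_topologicalClosure _).completeSpace_coe
  have hsep : IsSeparable (S : Set V) := hw'.isSeparable_range.span.closure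
  have : SeparableSpace S := hsep.separableSpace
  let w₀ : X → S := fun x =>
    ⟨w' x, Submodule.le_topologicalClosure _ (Submodule.subset_span ⟨x, rfl⟩)⟩
  have hw₀ : MemLp w₀ 2 μ := by
    refine ⟨?_, ?_⟩
    · exact (Topology.IsEmbedding.subtypeVal.aestronglyMeasurable_comp_iff (g := Subtype.val)
        (f := w₀)).1 hw'.aestronglyMeasurable
    · rw [← eLpNorm_norm]
      exact ((eLpNorm_norm _).trans (eLpNorm_congr_ae hww'.symm)).trans_lt hw.2
  have h := tsum_enorm_integral_smul_sq_of_separable e hw₀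
  have hR : ∫⁻ x, ‖w x‖ₑ ^ 2 ∂μ = ∫⁻ x, ‖w₀ x‖ₑ ^ 2 ∂μ := by
    refine lintegral_congr_ae ?_
    filter_upwards [hww'] with x hx
    rw [hx]
    rfl
  rw [hR, ← h]
  refine tsum_congr fun i => ?_
  have h1 : ∫ x, e i x • w x ∂μ = ∫ x, S.subtypeL (e i x • w₀ x) ∂μ := by
    refine integral_congr_ae ?_
    filter_upwards [hww'] with x hx
    rw [hx, map_smul]
    rfl
  have h2 : Integrable (fun x => e i x • w₀ x) μ :=
    memLp_one_iff_integrable.1 (hw₀.smul (Lp.memLp (e i)))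
  rw [h1, S.subtypeL.integral_comp_comm h2]
  rfl

end Parseval

/-! ### The trace of the image of a rank one operator -/

section Trace

open InnerProductSpace ComplexConjugate

variable {X : Type*} [TopologicalSpace X] [T2Space X] [MeasurableSpace X] [BorelSpace X]
  {μ : Measure X} [SigmaFinite μ]

/-- Neither X nor V need be second countable. Inner regularity and σ-finiteness exhaust μ up to a
null set by countably many compact sets, and on a compact set a continuous map is strongly
measurable. -/
theorem aestronglyMeasurable_of_continuous [μ.InnerRegularCompactLTTop] {V : Type*}
    [NormedAddCommGroup V] {v : X → V} (hv : Continuous v) : AEStronglyMeasurable v μ := by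
  have hK : ∀ n m : ℕ, ∃ K ⊆ spanningSets μ n, IsCompact K ∧
      μ (spanningSets μ n \ K) < ((m : ℝ≥0∞) + 1)⁻¹ := fun n m => by
    obtain ⟨K, hK, hKc, -, h⟩ := (measurableSet_spanningSets μ n).exists_isCompact_isClosed_sdiff_lt
      (measure_spanningSets_lt_top μ n).ne (ε := ((m : ℝ≥0∞) + 1)⁻¹) (by simp)
    exact ⟨K, hK, hKc, h⟩
  choose K hKs hKc hKμ using hK
  have hnull : μ (⋃ p : ℕ × ℕ, K p.1 p.2)ᶜ = 0 := by
    have hsub : (⋃ p : ℕ × ℕ, K p.1 p.2)ᶜ ⊆ ⋃ n, (spanningSets μ n \ ⋃ m, K n m) := fun x hx => by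
      obtain ⟨n, hn⟩ := Set.mem_iUnion.1 ((iUnion_spanningSets μ).symm ▸ Set.mem_univ x)
      refine Set.mem_iUnion.2 ⟨n, hn, fun h => hx ?_⟩
      obtain ⟨m, hm⟩ := Set.mem_iUnion.1 h
      exact Set.mem_iUnion.2 ⟨(n, m), hm⟩
    refine measure_mono_null hsub (measure_iUnion_null fun n => ?_)
    refine le_antisymm (ge_of_tendsto' (f := fun m : ℕ => ((m : ℝ≥0∞) + 1)⁻¹)
      (x := Filter.atTop) ?_ fun m => ?_) zero_le
    · have := (Filter.tendsto_add_atTop_iff_nat 1).2 ENNReal.tendsto_inv_nat_nhds_zero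
      simpa using this
    · exact (measure_mono (Set.sdiff_subset_sdiff_right (Set.subset_iUnion _ m))).trans (hKμ n m).le
  have hr : μ.restrict (⋃ p : ℕ × ℕ, K p.1 p.2) = μ :=
    Measure.restrict_eq_self_of_ae_mem hnull
  rw [← hr, aestronglyMeasurable_iUnion_iff]
  exact fun p => hv.continuousOn.aestronglyMeasurable_of_isCompact (hKc _ _)
    (hKc _ _).measurableSet

/-- For a positive Schur multiplier with continuous symbol,
`tr M_φ(|ξ⟩⟨ξ|) = ∫ φ(x, x) |ξ(x)|² dμ(x)`, and the symbol is nonnegative on the diagonal. -/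
theorem IsSchurMultiplier.posTrace_rankOne [μ.InnerRegularCompactLTTop] [μ.IsOpenPosMeasure]
    [IsLocallyFiniteMeasure μ] {φ : X × X → ℂ} (hφ : Continuous φ)
    {M : (Lp ℂ 2 μ →L[ℂ] Lp ℂ 2 μ) →ₗ[ℂ] (Lp ℂ 2 μ →L[ℂ] Lp ℂ 2 μ)}
    (hM : IsSchurMultiplier μ φ M) (hpos : IsPositiveMap M) :
    (∀ x, φ (x, x) = (‖φ (x, x)‖ : ℂ)) ∧
    ∀ ξ : Lp ℂ 2 μ, posTrace (M (rankOne ℂ ξ ξ)) = ∫⁻ x, ‖φ (x, x)‖ₑ * ‖ξ x‖ₑ ^ 2 ∂μ := by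
  obtain ⟨V, _, _, _, v, hv⟩ := exists_inner_eq_of_posDef (fun x y => φ (x, y))
    (hM.conj_symm hφ hpos) (hM.re_sum_nonneg hφ hpos)
  have hdiag : ∀ x, φ (x, x) = ((‖v x‖ ^ 2 : ℝ) : ℂ) := fun x => by
    rw [← hv, inner_self_eq_norm_sq_to_K]
    norm_cast
  have hnorm : ∀ x, ‖φ (x, x)‖ = ‖v x‖ ^ 2 := fun x => by
    rw [hdiag, Complex.norm_real, Real.norm_of_nonneg (by positivity)]
  refine ⟨fun x => by rw [hnorm, hdiag], fun ξ => ?_⟩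
  -- ‖v y − v x‖² = φ(y,y) − 2 Re φ(y,x) + φ(x,x), which is continuous in y and vanishes at y = x.
  have hvc : Continuous v := by
    refine continuous_iff_continuousAt.2 fun x => tendsto_iff_norm_sub_tendsto_zero.2 ?_
    have h1 : Continuous fun y => Real.sqrt
        (‖φ (y, y)‖ - 2 * (φ (y, x)).re + ‖φ (x, x)‖) := by fun_prop
    have h2 : ∀ y, Real.sqrt (‖φ (y, y)‖ - 2 * (φ (y, x)).re + ‖φ (x, x)‖) = ‖v y - v x‖ :=
      fun y => by
        rw [← Real.sqrt_sq (norm_nonneg (v y - v x)), norm_sub_sq (𝕜 := ℂ), hnorm, hnorm, hv]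
        rfl
    simp_rw [h2] at h1
    simpa using h1.tendsto x
  obtain ⟨C, hC⟩ := exists_bound_of_memLp_top hφ hM.choose
  have hvm : AEStronglyMeasurable v μ := aestronglyMeasurable_of_continuous hvc
  have hvb : MemLp v ∞ μ := by
    refine memLp_top_of_bound hvm (Real.sqrt C) (Filter.Eventually.of_forall fun x => ?_)
    exact Real.le_sqrt_of_sq_le ((hnorm x).symm.le.trans (hC _))
  have hξc : MemLp (fun x => conj (ξ x)) 2 μ := (Lp.memLp ξ).star
  have hw : MemLp (fun x => conj (ξ x) • v x) 2 μ := hvb.smul hξc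
  -- Substituting φ(x,y) = ⟨v x, v y⟩ turns the double integral into ⟨I, I⟩.
  have hval : ∀ η : Lp ℂ 2 μ, (inner ℂ η (M (rankOne ℂ ξ ξ) η)).re =
      ‖∫ x, η x • (conj (ξ x) • v x) ∂μ‖ ^ 2 := fun η => by
    have hint : Integrable (fun x => η x • (conj (ξ x) • v x)) μ :=
      memLp_one_iff_integrable.1 (hw.smul (Lp.memLp η))
    set I := ∫ x, η x • (conj (ξ x) • v x) ∂μ with hI
    have h1 : ∀ x, ∫ y, φ (x, y) * (conj (ξ y) * η y) ∂μ = inner ℂ (v x) I := fun x => by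
      rw [hI, ← integral_inner hint]
      refine integral_congr_ae (Filter.Eventually.of_forall fun y => ?_)
      simp only [inner_smul_right, hv]
      ring
    have h2 : inner ℂ η (M (rankOne ℂ ξ ξ) η) = inner ℂ I I := by
      have h3 : inner ℂ I I = ∫ x, inner ℂ I (η x • (conj (ξ x) • v x)) ∂μ :=
        (integral_inner hint I).symm
      rw [hM.inner_rankOne, ← inner_conj_symm I I, h3, ← integral_conj]
      refine integral_congr_ae (Filter.Eventually.of_forall fun x => ?_)
      simp only [h1, inner_smul_right, map_mul, inner_conj_symm, Complex.conj_conj]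
      ring
    rw [h2]
    exact inner_self_eq_norm_sq (𝕜 := ℂ) I
  simp only [posTrace, hval, ENNReal.ofReal_pow (norm_nonneg _), ofReal_norm]
  rw [tsum_enorm_integral_smul_sq _ hw]
  refine lintegral_congr fun x => ?_
  rw [enorm_smul, mul_pow, RCLike.enorm_conj, mul_comm, ← ofReal_norm (φ (x, x)), hnorm,
    ENNReal.ofReal_pow (norm_nonneg _), ofReal_norm]

end Trace

end SchurMult

end

/-- `X` is a locally compact Hausdorff space with its Borel sets and `μ` is a `σ`-finite Radon
measure on it with full support. The two classes that express `Radon` (finite on compact sets, and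
inner regular by compact sets on measurable sets of finite measure) are implied by each of the two
usual definitions, `Measure.Regular` and locally finite plus `Measure.InnerRegular`. -/
theorem mainTheorem8 {X : Type*} [TopologicalSpace X] [T2Space X] [LocallyCompactSpace X]
    [MeasurableSpace X] [BorelSpace X] (μ : Measure X) [IsFiniteMeasureOnCompacts μ]
    [μ.InnerRegularCompactLTTop] [SigmaFinite μ] [μ.IsOpenPosMeasure]
    (φ : X × X → ℂ) (hφ : Continuous φ)
    (M : (Lp ℂ 2 μ →L[ℂ] Lp ℂ 2 μ) →ₗ[ℂ] (Lp ℂ 2 μ →L[ℂ] Lp ℂ 2 μ))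
    (hM : SchurMult.IsSchurMultiplier μ φ M) (hpos : SchurMult.IsPositiveMap M) :
    SchurMult.IsTracePreserving M ↔ ∀ x : X, φ (x, x) = 1 := by
  have : IsLocallyFiniteMeasure μ := isLocallyFiniteMeasure_of_isFiniteMeasureOnCompacts
  obtain ⟨hdiag, htrace⟩ := hM.posTrace_rankOne hφ hpos
  rw [hpos.isTracePreserving_iff]
  simp_rw [htrace, SchurMult.enorm_sq_eq_lintegral]
  refine ⟨fun h => ?_, fun h ξ => by simp [h]⟩
  have hcont : Continuous fun x : X => ‖φ (x, x)‖ₑ := by fun_prop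
  -- Taking ξ to be the indicator of A gives ∫_A φ(x,x) dμ = μ(A) for every A of finite measure.
  have hae : (fun x => ‖φ (x, x)‖ₑ) =ᵐ[μ] fun _ => 1 := by
    refine ae_eq_of_forall_setLIntegral_eq_of_sigmaFinite hcont.measurable measurable_const
      fun A hA hμA => ?_
    have hA' := h (indicatorConstLp 2 hA hμA.ne 1)
    have hind : ∀ᵐ x ∂μ, ‖indicatorConstLp 2 hA hμA.ne (1 : ℂ) x‖ₑ ^ 2 =
        A.indicator (fun _ => 1) x := by
      filter_upwards [indicatorConstLp_coeFn (p := 2) (hs := hA) (hμs := hμA.ne) (c := (1 : ℂ))]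
        with x hx
      rw [hx]
      by_cases hxA : x ∈ A <;> simp [hxA]
    rw [lintegral_congr_ae hind, lintegral_congr_ae (hind.mono fun x hx => by rw [hx]),
      lintegral_indicator hA] at hA'
    rw [← hA', ← lintegral_indicator hA]
    refine lintegral_congr fun x => ?_
    by_cases hxA : x ∈ A <;> simp [hxA]
  have heq := (hcont.ae_eq_iff_eq μ continuous_const).1 hae
  intro x
  have hx : ‖φ (x, x)‖ = 1 := by
    rw [← toReal_enorm, congrFun heq x, ENNReal.toReal_one]
  -- The diagonal is nonnegative, so modulus 1 forces the value 1.
  rw [hdiag, hx, Complex.ofReal_one]
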